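/- Let $H$ be a complex Hilbert space with a fixed orthonormal basis $(e_i)_{i\in\mathbb N}$. For $k\in\mathbb N$ let $\mathbb B^{(k)}(H)$ be the set of bounded operators $a$ on $H$ such that each line and each column of the matrix $(\langle e_i, a e_j\rangle)_{i,j\in\mathbb N}$ has at most $k$ non-zero entries, and let $\mathbb B_f(H)$ be the operator-norm closure of $\bigcup_{k\in\mathbb N}\mathbb B^{(k)}(H)$, which is a unital $C^*$-subalgebra of the algebra of bounded operators on $H$. For $n\in\mathbb N$ let $\mathbb F_n$ be the free group on $n$ generators and let $C^*(\mathbb F_n)$ be its full group $C^*$-algebra, i.e. the completion of the group algebra $\mathbb C[\mathbb F_n]$ in the universal norm $\|a\|=\sup_\pi\|\pi(a)\|$, where $\pi$ runs over all unitary representations of $\mathbb F_n$ on complex Hilbert spaces. Then there is an injective unital $*$-homomorphism $C^*(\mathbb F_n)\to\mathbb B_f(H)$. -/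

import Mathlib

open scoped ComplexConjugate InnerProductSpace

noncomputable section

/-! ### Matrix-finite operators -/

namespace MatrixFinite

variable {H : Type*} [NormedAddCommGroup H] [InnerProductSpace ℂ H] [CompleteSpace H]

/-- The matrix entry `⟨e i, a (e j)⟩` of the bounded operator `a` in the basis `e`. -/
def entry (e : HilbertBasis ℕ ℂ H) (a : H →L[ℂ] H) (i j : ℕ) : ℂ := ⟪e i, a (e j)⟫_ℂ

/-- Operators each line of whose matrix has at most `k` non-zero entries. -/
def lineFinite (e : HilbertBasis ℕ ℂ H) (k : ℕ) : Set (H →L[ℂ] H) :=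
  {a | ∀ i, {j | entry e a i j ≠ 0}.encard ≤ k}

/-- Operators each column of whose matrix has at most `k` non-zero entries. -/
def columnFinite (e : HilbertBasis ℕ ℂ H) (k : ℕ) : Set (H →L[ℂ] H) :=
  {a | ∀ j, {i | entry e a i j ≠ 0}.encard ≤ k}

theorem entry_star (e : HilbertBasis ℕ ℂ H) (a : H →L[ℂ] H) (i j : ℕ) :
    entry e (star a) i j = conj (entry e a j i) := by
  simp [entry, ContinuousLinearMap.star_eq_adjoint, ContinuousLinearMap.adjoint_inner_right]

theorem entry_add (e : HilbertBasis ℕ ℂ H) (a b : H →L[ℂ] H) (i j : ℕ) :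
    entry e (a + b) i j = entry e a i j + entry e b i j := by
  simp [entry]

theorem exists_entry_ne_zero (e : HilbertBasis ℕ ℂ H) (a b : H →L[ℂ] H) (i l : ℕ)
    (h : entry e (a * b) i l ≠ 0) : ∃ j, entry e a i j ≠ 0 ∧ entry e b j l ≠ 0 := by
  by_contra! hc
  apply h
  have h1 := (e.hasSum_inner_mul_inner (star a (e i)) (b (e l))).tsum_eq
  have h2 : entry e (a * b) i l = ⟪star a (e i), b (e l)⟫_ℂ := by
    simp [entry, ContinuousLinearMap.star_eq_adjoint, ContinuousLinearMap.adjoint_inner_left]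
  rw [h2, ← h1]
  convert tsum_zero with j
  by_cases h0 : entry e a i j = 0
  · rw [mul_eq_zero]
    left
    simpa [entry, ContinuousLinearMap.star_eq_adjoint,
      ContinuousLinearMap.adjoint_inner_left] using h0
  · rw [mul_eq_zero]
    right
    exact hc j h0

theorem star_mem_columnFinite {e : HilbertBasis ℕ ℂ H} {k : ℕ} {a : H →L[ℂ] H}
    (h : a ∈ lineFinite e k) : star a ∈ columnFinite e k := by
  intro j
  simpa [entry_star] using h j

theorem star_mem_lineFinite {e : HilbertBasis ℕ ℂ H} {k : ℕ} {a : H →L[ℂ] H}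
    (h : a ∈ columnFinite e k) : star a ∈ lineFinite e k := by
  intro j
  simpa [entry_star] using h j

theorem add_mem_lineFinite {e : HilbertBasis ℕ ℂ H} {k l : ℕ} {a b : H →L[ℂ] H}
    (ha : a ∈ lineFinite e k) (hb : b ∈ lineFinite e l) : a + b ∈ lineFinite e (k + l) := by
  intro i
  refine (Set.encard_le_encard (t := {j | entry e a i j ≠ 0} ∪ {j | entry e b i j ≠ 0}) ?_).trans
    ((Set.encard_union_le _ _).trans ?_)
  · intro j hj
    by_contra hc
    simp only [Set.mem_union, Set.mem_ofPred_eq, not_or, not_not] at hc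
    exact hj (by rw [entry_add, hc.1, hc.2, add_zero])
  · push_cast
    exact add_le_add (ha i) (hb i)

theorem mul_mem_lineFinite {e : HilbertBasis ℕ ℂ H} {k l : ℕ} {a b : H →L[ℂ] H}
    (ha : a ∈ lineFinite e k) (hb : b ∈ lineFinite e l) : a * b ∈ lineFinite e (k * l) := by
  intro i
  have hfin : {j | entry e a i j ≠ 0}.Finite :=
    Set.finite_of_encard_le_coe (ha i)
  have hfin' : ∀ j, {m | entry e b j m ≠ 0}.Finite := fun j =>
    Set.finite_of_encard_le_coe (hb j)
  have hcard : ∀ j, (hfin' j).toFinset.card ≤ l := fun j => by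
    have := hb j
    rw [(hfin' j).encard_eq_coe_toFinset_card] at this
    exact_mod_cast this
  have hcard' : hfin.toFinset.card ≤ k := by
    have := ha i
    rw [hfin.encard_eq_coe_toFinset_card] at this
    exact_mod_cast this
  have hsub : {m | entry e (a * b) i m ≠ 0} ⊆
      ((hfin.toFinset.biUnion fun j => (hfin' j).toFinset : Finset ℕ) : Set ℕ) := by
    intro m hm
    obtain ⟨j, h1, h2⟩ := exists_entry_ne_zero e a b i m hm
    simp only [Finset.coe_biUnion, Set.mem_iUnion]
    exact ⟨j, by simpa using h1, by simpa using h2⟩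
  refine (Set.encard_le_encard hsub).trans ?_
  rw [Set.encard_coe_eq_coe_finsetCard]
  have := Finset.card_biUnion_le_card_mul hfin.toFinset (fun j => (hfin' j).toFinset) l
    (fun j _ => hcard j)
  exact_mod_cast this.trans (Nat.mul_le_mul_right l hcard')

theorem algebraMap_mem_lineFinite (e : HilbertBasis ℕ ℂ H) (r : ℂ) :
    algebraMap ℂ (H →L[ℂ] H) r ∈ lineFinite e 1 := by
  intro i
  rw [Nat.cast_one, Set.encard_le_one_iff]
  have key : ∀ j, entry e (algebraMap ℂ (H →L[ℂ] H) r) i j ≠ 0 → i = j := by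
    intro j hj
    by_contra hij
    apply hj
    simp [entry, Algebra.algebraMap_eq_smul_one, e.orthonormal.2 hij]
  intro j j' hj hj'
  rw [← key j hj, ← key j' hj']

/-- The unital `*`-algebra of operators such that, for some `k`, each line and each column of the
matrix has at most `k` non-zero entries. -/
def finiteOps (e : HilbertBasis ℕ ℂ H) : StarSubalgebra ℂ (H →L[ℂ] H) where
  carrier := ⋃ k, lineFinite e k ∩ columnFinite e k
  mul_mem' := by
    intro a b ha hb
    obtain ⟨k, hk⟩ := Set.mem_iUnion.1 ha
    obtain ⟨l, hl⟩ := Set.mem_iUnion.1 hb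
    refine Set.mem_iUnion.2 ⟨k * l, mul_mem_lineFinite hk.1 hl.1, ?_⟩
    rw [mul_comm k l, ← star_star (a * b), star_mul]
    exact star_mem_columnFinite (mul_mem_lineFinite (star_mem_lineFinite hl.2)
      (star_mem_lineFinite hk.2))
  add_mem' := by
    intro a b ha hb
    obtain ⟨k, hk⟩ := Set.mem_iUnion.1 ha
    obtain ⟨l, hl⟩ := Set.mem_iUnion.1 hb
    refine Set.mem_iUnion.2 ⟨k + l, add_mem_lineFinite hk.1 hl.1, ?_⟩
    rw [← star_star (a + b), star_add]
    exact star_mem_columnFinite (add_mem_lineFinite (star_mem_lineFinite hk.2)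
      (star_mem_lineFinite hl.2))
  algebraMap_mem' := by
    intro r
    refine Set.mem_iUnion.2 ⟨1, algebraMap_mem_lineFinite e r, ?_⟩
    rw [← star_star (algebraMap ℂ (H →L[ℂ] H) r), ← algebraMap_star_comm]
    exact star_mem_columnFinite (algebraMap_mem_lineFinite e _)
  star_mem' := by
    intro a ha
    obtain ⟨k, hk⟩ := Set.mem_iUnion.1 ha
    exact Set.mem_iUnion.2 ⟨k, star_mem_lineFinite hk.2, star_mem_columnFinite hk.1⟩

/-- The C⋆-algebra of matrix-finite operators: the operator norm closure of `finiteOps e`. -/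
def Bf (e : HilbertBasis ℕ ℂ H) : StarSubalgebra ℂ (H →L[ℂ] H) :=
  (finiteOps e).topologicalClosure

end MatrixFinite

/-! ### The full group C⋆-algebra -/

universe u

/-- The complex group algebra `ℂ[G]`, as a type to carry the universal C⋆-seminorm. -/
def GroupAlg (G : Type u) [Group G] : Type u := MonoidAlgebra ℂ G

namespace GroupAlg

variable {G : Type u} [Group G]

instance : Ring (GroupAlg G) := inferInstanceAs (Ring (MonoidAlgebra ℂ G))

instance : Algebra ℂ (GroupAlg G) := inferInstanceAs (Algebra ℂ (MonoidAlgebra ℂ G))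

/-- The group element `g` times the scalar `c` in the group algebra. -/
def single (g : G) (c : ℂ) : GroupAlg G := MonoidAlgebra.single g c

/-- The canonical involution `(∑ c_g g)⋆ = ∑ conj c_g g⁻¹`. -/
instance : Star (GroupAlg G) where
  star a := MonoidAlgebra.ofCoeff
    (Finsupp.equivMapDomain (Equiv.inv G)
      (Finsupp.mapRange (starRingEnd ℂ) (map_zero _) (MonoidAlgebra.coeff a)))

theorem star_single (g : G) (c : ℂ) : star (single g c) = single g⁻¹ (conj c) := by
  change MonoidAlgebra.ofCoeff _ = _
  simp [single]

theorem single_mul_single (g h : G) (c d : ℂ) :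
    single g c * single h d = single (g * h) (c * d) :=
  MonoidAlgebra.single_mul_single g h c d

theorem star_add' (a b : GroupAlg G) : star (a + b) = star a + star b := by
  apply MonoidAlgebra.ext
  apply Finsupp.ext
  intro g
  exact map_add (starRingEnd ℂ) _ _

theorem induction {p : GroupAlg G → Prop} (a : GroupAlg G) (h0 : p 0)
    (hadd : ∀ a b, p a → p b → p (a + b)) (hs : ∀ g c, p (single g c)) : p a :=
  MonoidAlgebra.induction_linear a h0 (fun a b => hadd a b) hs

theorem star_zero' : star (0 : GroupAlg G) = 0 := by
  have := star_add' (0 : GroupAlg G) 0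
  simpa using this

instance : StarRing (GroupAlg G) where
  star_involutive a := by
    induction a using GroupAlg.induction with
    | h0 => rw [star_zero', star_zero']
    | hadd a b ha hb => rw [star_add', star_add', ha, hb]
    | hs g c => rw [star_single, star_single, inv_inv, Complex.conj_conj]
  star_mul a b := by
    induction a using GroupAlg.induction with
    | h0 => simp [star_zero']
    | hadd a a' ha hb => rw [add_mul, star_add', star_add', mul_add, ha, hb]
    | hs g c =>
      induction b using GroupAlg.induction with
      | h0 => simp [star_zero']
      | hadd a a' ha hb => rw [mul_add, star_add', star_add', add_mul, ha, hb]
      | hs h d => simp [single_mul_single, star_single, mul_comm]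
  star_add := star_add'

theorem smul_single (r : ℂ) (g : G) (c : ℂ) : r • single g c = single g (r * c) :=
  MonoidAlgebra.smul_single r g c

instance : StarModule ℂ (GroupAlg G) where
  star_smul r a := by
    induction a using GroupAlg.induction with
    | h0 => simp
    | hadd a b ha hb => rw [smul_add, star_add, star_add, smul_add, ha, hb]
    | hs g c => simp [smul_single, star_single]

section Rep

variable {K : Type*} [NormedAddCommGroup K] [InnerProductSpace ℂ K] [CompleteSpace K]

/-- The integrated form `∑ c_g g ↦ ∑ c_g π(g)` of a unitary representation `π` of `G`. -/
def integrated (π : G →* unitary (K →L[ℂ] K)) : GroupAlg G →ₐ[ℂ] (K →L[ℂ] K) :=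
  MonoidAlgebra.lift ℂ (K →L[ℂ] K) G ((unitary (K →L[ℂ] K)).subtype.comp π)

theorem integrated_single (π : G →* unitary (K →L[ℂ] K)) (g : G) (c : ℂ) :
    integrated π (single g c) = c • (π g : K →L[ℂ] K) := by
  unfold integrated single
  erw [MonoidAlgebra.lift_single]
  rfl

theorem integrated_star (π : G →* unitary (K →L[ℂ] K)) (a : GroupAlg G) :
    integrated π (star a) = star (integrated π a) := by
  induction a using GroupAlg.induction with
  | h0 => simp
  | hadd a b ha hb => rw [star_add, map_add, map_add, star_add, ha, hb]
  | hs g c =>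
    rw [star_single, integrated_single, integrated_single, star_smul, map_inv]
    rfl

end Rep

/-- The operator norms `‖π(a)‖`, for `π` a unitary representation of `G` on a complex Hilbert
space. Hilbert spaces in the universe of `G` suffice, as cyclic representations of `G` live there
up to unitary equivalence. -/
def repNorms (a : GroupAlg G) : Set ℝ :=
  {r | ∃ (K : Type u) (_ : NormedAddCommGroup K) (_ : InnerProductSpace ℂ K)
    (_ : CompleteSpace K) (π : G →* unitary (K →L[ℂ] K)), r = ‖integrated π a‖}

/-- The universal norm on `ℂ[G]`: the supremum of `‖π(a)‖` over all unitary representations. -/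
def univNorm (a : GroupAlg G) : ℝ := sSup (repNorms a)

theorem repNorms_nonempty (a : GroupAlg G) : (repNorms a).Nonempty :=
  ⟨_, PUnit, inferInstance, inferInstance, inferInstance, 1, rfl⟩

theorem repNorms_bddAbove (a : GroupAlg G) : BddAbove (repNorms a) := by
  induction a using GroupAlg.induction with
  | h0 =>
    refine ⟨0, ?_⟩
    rintro r ⟨K, _, _, _, π, rfl⟩
    simp
  | hadd a b ha hb =>
    obtain ⟨A, hA⟩ := ha
    obtain ⟨B, hB⟩ := hb
    refine ⟨A + B, ?_⟩
    rintro r ⟨K, i1, i2, i3, π, rfl⟩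
    rw [map_add]
    exact (norm_add_le _ _).trans
      (add_le_add (hA ⟨K, i1, i2, i3, π, rfl⟩) (hB ⟨K, i1, i2, i3, π, rfl⟩))
  | hs g c =>
    refine ⟨‖c‖, ?_⟩
    rintro r ⟨K, i1, i2, i3, π, rfl⟩
    rw [integrated_single, norm_smul]
    refine mul_le_of_le_one_right (norm_nonneg c) ?_
    rcases subsingleton_or_nontrivial K with h | h
    · rw [Subsingleton.elim (π g : K →L[ℂ] K) 0, norm_zero]
      exact zero_le_one
    · exact (CStarRing.norm_coe_unitary (π g)).le

theorem norm_integrated_le {K : Type u} [NormedAddCommGroup K] [InnerProductSpace ℂ K]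
    [CompleteSpace K] (π : G →* unitary (K →L[ℂ] K)) (a : GroupAlg G) :
    ‖integrated π a‖ ≤ univNorm a :=
  le_csSup (repNorms_bddAbove a) ⟨K, _, _, _, π, rfl⟩

theorem univNorm_le {a : GroupAlg G} {C : ℝ}
    (h : ∀ (K : Type u) [NormedAddCommGroup K] [InnerProductSpace ℂ K] [CompleteSpace K]
      (π : G →* unitary (K →L[ℂ] K)), ‖integrated π a‖ ≤ C) : univNorm a ≤ C := by
  refine csSup_le (repNorms_nonempty a) ?_
  rintro r ⟨K, i1, i2, i3, π, rfl⟩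
  exact h K π

theorem univNorm_nonneg (a : GroupAlg G) : 0 ≤ univNorm a :=
  (norm_nonneg _).trans (norm_integrated_le (K := PUnit) 1 a)

theorem univNorm_add_le (a b : GroupAlg G) : univNorm (a + b) ≤ univNorm a + univNorm b := by
  refine univNorm_le fun K _ _ _ π => ?_
  rw [map_add]
  exact (norm_add_le _ _).trans (add_le_add (norm_integrated_le π a) (norm_integrated_le π b))

theorem univNorm_mul_le (a b : GroupAlg G) : univNorm (a * b) ≤ univNorm a * univNorm b := by
  refine univNorm_le fun K _ _ _ π => ?_
  rw [map_mul]
  exact (norm_mul_le _ _).trans (mul_le_mul (norm_integrated_le π a) (norm_integrated_le π b)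
    (norm_nonneg _) (univNorm_nonneg a))

/-- The universal norm, as a seminorm on the ring `ℂ[G]`. -/
def univRingSeminorm (G : Type u) [Group G] : RingSeminorm (GroupAlg G) where
  toFun := univNorm
  map_zero' := le_antisymm (univNorm_le fun K _ _ _ π => by simp) (univNorm_nonneg 0)
  add_le' := univNorm_add_le
  neg' a := by simp only [univNorm, repNorms, map_neg, norm_neg]
  mul_le' := univNorm_mul_le

instance : SeminormedRing (GroupAlg G) := (univRingSeminorm G).toSeminormedRing

theorem norm_eq (a : GroupAlg G) : ‖a‖ = univNorm a := rfl

instance : NormedAlgebra ℂ (GroupAlg G) where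
  norm_smul_le r a := by
    rw [norm_eq, norm_eq]
    refine univNorm_le fun K _ _ _ π => ?_
    rw [map_smul, norm_smul]
    exact mul_le_mul_of_nonneg_left (norm_integrated_le π a) (norm_nonneg r)

instance : NormedStarGroup (GroupAlg G) where
  norm_star_le a := by
    rw [norm_eq, norm_eq]
    refine univNorm_le fun K _ _ _ π => ?_
    rw [integrated_star, norm_star]
    exact norm_integrated_le π a

theorem norm_mul_self_le (a : GroupAlg G) : ‖a‖ * ‖a‖ ≤ ‖star a * a‖ := by
  have h : ‖a‖ ≤ √‖star a * a‖ := by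
    rw [norm_eq a]
    refine univNorm_le fun K _ _ _ π => Real.le_sqrt_of_sq_le ?_
    rw [sq, ← CStarRing.norm_star_mul_self, ← integrated_star, ← map_mul]
    exact norm_integrated_le π _
  calc ‖a‖ * ‖a‖ ≤ √‖star a * a‖ * √‖star a * a‖ :=
        mul_self_le_mul_self (norm_nonneg a) h
    _ = ‖star a * a‖ := Real.mul_self_sqrt (norm_nonneg _)

end GroupAlg

/-- The full group C⋆-algebra `C⋆(G)` of the discrete group `G`: the Hausdorff completion of
`ℂ[G]` in the universal norm. -/
def FullGroupCStar (G : Type u) [Group G] : Type u := UniformSpace.Completion (GroupAlg G)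

namespace FullGroupCStar

open UniformSpace

variable {G : Type u} [Group G]

instance : NormedRing (FullGroupCStar G) :=
  inferInstanceAs (NormedRing (Completion (GroupAlg G)))

instance : CompleteSpace (FullGroupCStar G) :=
  inferInstanceAs (CompleteSpace (Completion (GroupAlg G)))

instance : Algebra ℂ (FullGroupCStar G) :=
  inferInstanceAs (Algebra ℂ (Completion (GroupAlg G)))

/-- The canonical map `ℂ[G] → C⋆(G)`. -/
def of (a : GroupAlg G) : FullGroupCStar G := (a : Completion (GroupAlg G))

/-- The involution of `C⋆(G)`: the continuous extension of the involution of `ℂ[G]`. -/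
instance : Star (FullGroupCStar G) where
  star := Completion.map (star : GroupAlg G → GroupAlg G)

theorem norm_of (a : GroupAlg G) : ‖of a‖ = GroupAlg.univNorm a := Completion.norm_coe a

theorem of_add (a b : GroupAlg G) : of (a + b) = of a + of b := Completion.coe_add a b

theorem of_mul (a b : GroupAlg G) : of (a * b) = of a * of b := Completion.coe_mul a b

theorem of_smul (r : ℂ) (a : GroupAlg G) : of (r • a) = r • of a := Completion.coe_smul r a

theorem of_star (a : GroupAlg G) : of (star a) = star (of a) :=
  (Completion.map_coe (starₗᵢ ℂ : GroupAlg G ≃ₗᵢ⋆[ℂ] GroupAlg G).isometry.uniformContinuous a).symm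

theorem continuous_star' : Continuous (star : FullGroupCStar G → FullGroupCStar G) :=
  Completion.continuous_map

theorem denseRange_of : DenseRange (of : GroupAlg G → FullGroupCStar G) :=
  Completion.denseRange_coe

instance : StarRing (FullGroupCStar G) where
  star_involutive x := by
    refine denseRange_of.induction_on x
      (isClosed_eq (continuous_star'.comp continuous_star') continuous_id) fun a => ?_
    rw [← of_star, ← of_star, star_star]
  star_mul x y := by
    refine denseRange_of.induction_on₂ (p := fun x y => star (x * y) = star y * star x)
      (isClosed_eq (continuous_star'.comp continuous_mul)
        ((continuous_star'.comp continuous_snd).mul (continuous_star'.comp continuous_fst)))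
      (fun a b => ?_) x y
    rw [← of_mul, ← of_star, ← of_star, ← of_star, star_mul, of_mul]
  star_add x y := by
    refine denseRange_of.induction_on₂ (p := fun x y => star (x + y) = star x + star y)
      (isClosed_eq (continuous_star'.comp continuous_add)
        ((continuous_star'.comp continuous_fst).add (continuous_star'.comp continuous_snd)))
      (fun a b => ?_) x y
    rw [← of_add, ← of_star, ← of_star, ← of_star, star_add, of_add]

instance : CStarAlgebra (FullGroupCStar G) where
  norm_smul_le r x :=
    norm_smul_le (α := ℂ) (β := Completion (GroupAlg G)) r x
  norm_mul_self_le x := by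
    refine denseRange_of.induction_on x
      (isClosed_le (continuous_norm.mul continuous_norm)
        (continuous_norm.comp (continuous_star'.mul continuous_id))) fun a => ?_
    change ‖of a‖ * ‖of a‖ ≤ ‖star (of a) * of a‖
    rw [← of_star, ← of_mul, norm_of, norm_of]
    exact GroupAlg.norm_mul_self_le a
  star_smul r x := by
    have hs : ∀ c : ℂ, Continuous fun y : FullGroupCStar G => c • y := fun c =>
      continuous_const_smul (T := Completion (GroupAlg G)) c
    refine denseRange_of.induction_on x
      (isClosed_eq (continuous_star'.comp (hs r)) ((hs (star r)).comp continuous_star'))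
      fun a => ?_
    change star (r • of a) = star r • star (of a)
    rw [← of_smul, ← of_star, ← of_star, star_smul, of_smul]

end FullGroupCStar

end

/-!
The full group C⋆-algebra of a free group embeds into the algebra of matrix-finite operators
because permutation representations already attain the universal norm: there is one action of
`𝔽ₙ` on `ℕ` whose permutation representation `λ` satisfies `‖π(a)‖ ≤ ‖λ(a)‖` for every unitary
representation `π` and every `a ∈ ℂ[𝔽ₙ]`. A permutation matrix has one non-zero entry in each line
and column, so `λ(a)` is matrix-finite, and `λ` extends to an isometric `*`-homomorphism on the
completion (`FullGroupCStar.exists_isometric_extension`).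

The inequality is proved in two steps.

* *Reduction to finite dimension.* Given `π`, `a` and a vector `x`, choose a finite-dimensional
  subspace `F` containing the vectors `π(w) x` for the finitely many words `w` that matter. Each
  generator `π(gᵢ)` restricts to a partial isometry of `F`, which extends to a unitary of `F`. As
  the group is free, these unitaries define a representation `ρ` of `𝔽ₙ` on `F`, and
  `ρ(a) x = π(a) x` (`exists_finiteDimensional_integrated_apply_eq`).

* *Approximation by permutations.* Let `u` be a unitary of `F`, regarded as a rotation of `ℝᵈ`. Since
  `u` preserves volume, Hall's theorem and the Schröder–Bernstein theorem give a bijection `σ` of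
  `ℤᵈ` with `|σ p - u p|` bounded (`exists_perm_lattice_close_isometry`). Map `x ∈ F` to the
  function `p ↦ ⟪g p, x⟫` on `ℤᵈ`, where `g p = (R - ‖p‖)⁺ p`. By the symmetries of the lattice this
  is a multiple of an isometry (`sum_inner_tent_sq`), and it intertwines `u` and `σ` up to a
  relative error of order `1 / R`, because `g` has slope at most `2 R` on a ball of radius `R`, where
  its values have size `R ^ 2` (`exists_tent_energy`). Only finitely many lattice points
  matter, so `σ` can be replaced by a permutation of a finite set
  (`exists_approx_intertwiner`).

All tuples of permutations of finite sets together form an action on a countable set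
(`exists_isUniversalTuple`), which is the action on `ℕ` used above.
-/

/-! ### Permutation operators -/

namespace MatrixFinite

variable {H : Type*} [NormedAddCommGroup H] [InnerProductSpace ℂ H] [CompleteSpace H]

/-- The isometry of `H` that permutes the vectors of the basis `e` by `σ`. -/
noncomputable def permIsometry (e : HilbertBasis ℕ ℂ H) (σ : Equiv.Perm ℕ) : H ≃ₗᵢ[ℂ] H :=
  e.repr.trans (HilbertBasis.mk (v := e ∘ σ) (e.orthonormal.comp σ σ.injective)
    (by rw [σ.surjective.range_comp, e.dense_span])).repr.symm

theorem permIsometry_apply (e : HilbertBasis ℕ ℂ H) (σ : Equiv.Perm ℕ) (j : ℕ) :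
    permIsometry e σ (e j) = e (σ j) := by
  classical
  simp [permIsometry, HilbertBasis.repr_self, HilbertBasis.repr_symm_single]

theorem linearIsometryEquiv_ext_basis {H : Type*} [NormedAddCommGroup H]
    [InnerProductSpace ℂ H] (e : HilbertBasis ℕ ℂ H) {S T : H ≃ₗᵢ[ℂ] H}
    (h : ∀ j, S (e j) = T (e j)) : S = T := by
  have key : (S.toContinuousLinearEquiv : H →L[ℂ] H) = T.toContinuousLinearEquiv := by
    refine ContinuousLinearMap.ext_on (s := Set.range e) ?_ ?_
    · rw [dense_iff_closure_eq, ← Submodule.topologicalClosure_coe, e.dense_span]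
      rfl
    · rintro _ ⟨j, rfl⟩
      exact h j
  ext x
  exact congr($key x)

/-- The unitary operators that permute the vectors of the basis `e`. -/
noncomputable def permUnitary (e : HilbertBasis ℕ ℂ H) : Equiv.Perm ℕ →* unitary (H →L[ℂ] H) :=
  (Unitary.linearIsometryEquiv (𝕜 := ℂ) (H := H)).symm.toMonoidHom.comp
    { toFun := permIsometry e
      map_one' := linearIsometryEquiv_ext_basis e fun j => by simp [permIsometry_apply]
      map_mul' := fun σ τ => linearIsometryEquiv_ext_basis e fun j => by
        simp [permIsometry_apply] }

theorem permUnitary_apply (e : HilbertBasis ℕ ℂ H) (σ : Equiv.Perm ℕ) (j : ℕ) :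
    (permUnitary e σ : H →L[ℂ] H) (e j) = e (σ j) :=
  permIsometry_apply e σ j

theorem entry_permUnitary_ne_zero {e : HilbertBasis ℕ ℂ H} {σ : Equiv.Perm ℕ} {i j : ℕ}
    (h : entry e (permUnitary e σ : H →L[ℂ] H) i j ≠ 0) : i = σ j := by
  by_contra hij
  apply h
  rw [entry, permUnitary_apply, e.orthonormal.2 hij]

theorem permUnitary_mem_finiteOps (e : HilbertBasis ℕ ℂ H) (σ : Equiv.Perm ℕ) :
    (permUnitary e σ : H →L[ℂ] H) ∈ finiteOps e := by
  refine Set.mem_iUnion.2 ⟨1, fun i => ?_, fun j => ?_⟩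
  · rw [Nat.cast_one, Set.encard_le_one_iff]
    intro j j' hj hj'
    exact σ.injective ((entry_permUnitary_ne_zero hj).symm.trans (entry_permUnitary_ne_zero hj'))
  · rw [Nat.cast_one, Set.encard_le_one_iff]
    intro i i' hi hi'
    exact (entry_permUnitary_ne_zero hi).trans (entry_permUnitary_ne_zero hi').symm

/-- The unitary representation of the free group in which the `i`-th generator permutes the basis
`e` by `θ i`. -/
noncomputable def permRep (e : HilbertBasis ℕ ℂ H) {n : ℕ} (θ : Fin n → Equiv.Perm ℕ) :
    FreeGroup (Fin n) →* unitary (H →L[ℂ] H) :=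
  (permUnitary e).comp (FreeGroup.lift θ)

theorem integrated_permRep_mem_finiteOps (e : HilbertBasis ℕ ℂ H) {n : ℕ}
    (θ : Fin n → Equiv.Perm ℕ) (a : GroupAlg (FreeGroup (Fin n))) :
    GroupAlg.integrated (permRep e θ) a ∈ finiteOps e := by
  induction a using GroupAlg.induction with
  | h0 => rw [map_zero]; exact zero_mem _
  | hadd a b ha hb => rw [map_add]; exact add_mem ha hb
  | hs g c =>
    rw [GroupAlg.integrated_single]
    exact SMulMemClass.smul_mem c (permUnitary_mem_finiteOps e _)

end MatrixFinite

/-! ### A universal tuple of permutations -/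

/-- A tuple of permutations of `ℕ` that contains a copy of the restriction of every tuple of
permutations of a type to every finite set. The copy is given by `y`, which only needs to be
injective on the finite set and on each of its images. -/
def IsUniversalTuple {n : ℕ} (θ : Fin n → Equiv.Perm ℕ) : Prop :=
  ∀ (Λ : Type) (B : Finset Λ) (σ : Fin n → Equiv.Perm Λ), ∃ y : Λ → ℕ,
    (∀ i, Set.InjOn y (σ i '' B)) ∧ Set.InjOn y B ∧ ∀ i, ∀ p ∈ B, θ i (y p) = y (σ i p)

/-- On a finite set containing `B` and its images, the given permutations can be modified outside
`B` so as to preserve that set. -/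
theorem exists_perm_finset {n : ℕ} {Λ : Type} (B : Finset Λ) (σ : Fin n → Equiv.Perm Λ) :
    ∃ (S : Finset Λ) (τ : Fin n → Equiv.Perm S), B ⊆ S ∧
      (∀ i, ∀ p ∈ B, σ i p ∈ S) ∧ ∀ i (p : S), p.1 ∈ B → (τ i p : Λ) = σ i p := by
  classical
  let S : Finset Λ := B ∪ Finset.univ.biUnion fun i => B.image (σ i)
  have hB : B ⊆ S := Finset.subset_union_left
  have hS : ∀ i, ∀ p ∈ B, σ i p ∈ S := fun i p hp =>
    Finset.mem_union_right _ (Finset.mem_biUnion.2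
      ⟨i, Finset.mem_univ i, Finset.mem_image_of_mem _ hp⟩)
  let f : ∀ i, {s : S // s.1 ∈ B} ≃ {s : S // (σ i).symm s.1 ∈ B} := fun i =>
    { toFun := fun s => ⟨⟨σ i s.1.1, hS i _ s.2⟩, by simpa using s.2⟩
      invFun := fun s => ⟨⟨(σ i).symm s.1.1, hB s.2⟩, s.2⟩
      left_inv := fun s => by simp
      right_inv := fun s => by simp }
  refine ⟨S, fun i => (f i).extendSubtype, hB, hS, fun i p hp => ?_⟩
  have := (f i).extendSubtype_apply_of_mem p hp
  simp only [this]
  rfl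

/-- All tuples of permutations of the sets `Fin m` together form a universal tuple on a countable
set. -/
theorem exists_isUniversalTuple (n : ℕ) : ∃ θ : Fin n → Equiv.Perm ℕ, IsUniversalTuple θ := by
  let Y := Σ m : ℕ, (Fin n → Equiv.Perm (Fin m)) × Fin m
  have : Infinite Y := Infinite.of_injective (fun m : ℕ => (⟨m + 1, 1, 0⟩ : Y)) fun a b h => by
    simpa using congrArg Sigma.fst h
  obtain ⟨E⟩ : Nonempty (Y ≃ ℕ) := nonempty_equiv_of_countable
  let θY : Fin n → Equiv.Perm Y := fun i =>
    { toFun := fun z => ⟨z.1, z.2.1, z.2.1 i z.2.2⟩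
      invFun := fun z => ⟨z.1, z.2.1, (z.2.1 i).symm z.2.2⟩
      left_inv := fun z => by simp
      right_inv := fun z => by simp }
  refine ⟨fun i => E.permCongr (θY i), fun Λ B σ => ?_⟩
  classical
  obtain ⟨S, τ, hB, hS, hτ⟩ := exists_perm_finset B σ
  let ψ : S ≃ Fin S.card := S.equivFin
  let t : Fin n → Equiv.Perm (Fin S.card) := fun i => ψ.permCongr (τ i)
  let y : Λ → ℕ := fun p => if h : p ∈ S then E ⟨S.card, t, ψ ⟨p, h⟩⟩ else 0
  have hy : ∀ p (h : p ∈ S), y p = E ⟨S.card, t, ψ ⟨p, h⟩⟩ := fun p h => dif_pos h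
  have hinj : Set.InjOn y S := by
    intro p hp q hq hpq
    rw [hy p hp, hy q hq] at hpq
    have := E.injective hpq
    rw [Sigma.mk.injEq, heq_eq_eq, Prod.mk.injEq] at this
    exact congrArg Subtype.val (ψ.injective this.2.2)
  refine ⟨y, fun i => hinj.mono ?_, hinj.mono hB, fun i p hp => ?_⟩
  · rintro _ ⟨p, hp, rfl⟩
    exact hS i p hp
  · rw [hy p (hB hp), hy _ (hS i p hp)]
    have : (⟨σ i p, hS i p hp⟩ : S) = τ i ⟨p, hB hp⟩ := Subtype.ext (hτ i ⟨p, hB hp⟩ hp).symm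
    rw [this]
    simp [θY, t, Equiv.permCongr_apply]

/-! ### Compression to finite-dimensional representations -/

section Compression

variable {n : ℕ} {K : Type*} [NormedAddCommGroup K] [InnerProductSpace ℂ K] [CompleteSpace K]

open GroupAlg

/-- The representation `ρ` on the subspace `F` agrees with `π` on a generator whenever `π` keeps
the vector in `F`. -/
def IsCompatible (π : FreeGroup (Fin n) →* unitary (K →L[ℂ] K)) (F : Submodule ℂ K)
    [CompleteSpace F] (ρ : FreeGroup (Fin n) →* unitary (F →L[ℂ] F)) : Prop :=
  ∀ i, ∀ x : F, (π (FreeGroup.of i) : K →L[ℂ] K) x ∈ F →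
    ((ρ (FreeGroup.of i) : F →L[ℂ] F) x : K) = (π (FreeGroup.of i) : K →L[ℂ] K) x

/-- A partial isometry of a finite-dimensional space extends to a unitary, and unitaries can be
assigned freely to the generators of a free group. -/
theorem exists_isCompatible (π : FreeGroup (Fin n) →* unitary (K →L[ℂ] K)) (F : Submodule ℂ K)
    [FiniteDimensional ℂ F] :
    ∃ ρ : FreeGroup (Fin n) →* unitary (F →L[ℂ] F), IsCompatible π F ρ := by
  let u : Fin n → K ≃ₗᵢ[ℂ] K := fun i => Unitary.linearIsometryEquiv (π (FreeGroup.of i))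
  -- the largest subspace of `F` that the `i`-th generator maps into `F`
  let S : Fin n → Submodule ℂ F := fun i =>
    (F.comap (u i).toLinearEquiv.toLinearMap).comap F.subtype
  let L : ∀ i, S i →ₗᵢ[ℂ] F := fun i =>
    { toLinearMap := LinearMap.codRestrict F
        ((u i).toLinearEquiv.toLinearMap ∘ₗ F.subtype ∘ₗ (S i).subtype) fun x => x.2
      norm_map' := fun x => (u i).norm_map _ }
  let U : Fin n → F ≃ₗᵢ[ℂ] F := fun i => (L i).extend.toLinearIsometryEquiv rfl
  refine ⟨FreeGroup.lift fun i => Unitary.linearIsometryEquiv.symm (U i), fun i x hx => ?_⟩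
  rw [FreeGroup.lift_apply_of]
  change (((L i).extend x : F) : K) = _
  have := (L i).extend_apply ⟨x, hx⟩
  simp only at this
  rw [this]
  rfl

theorem unitary_inv_apply_apply {E : Type*} [NormedAddCommGroup E] [InnerProductSpace ℂ E]
    [CompleteSpace E] (v : unitary (E →L[ℂ] E)) (x : E) :
    ((v⁻¹ : unitary (E →L[ℂ] E)) : E →L[ℂ] E) ((v : E →L[ℂ] E) x) = x :=
  (Unitary.linearIsometryEquiv v).symm_apply_apply x

theorem unitary_apply_inv_apply {E : Type*} [NormedAddCommGroup E] [InnerProductSpace ℂ E]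
    [CompleteSpace E] (v : unitary (E →L[ℂ] E)) (x : E) :
    (v : E →L[ℂ] E) (((v⁻¹ : unitary (E →L[ℂ] E)) : E →L[ℂ] E) x) = x :=
  (Unitary.linearIsometryEquiv v).apply_symm_apply x

theorem unitary_norm_apply {E : Type*} [NormedAddCommGroup E] [InnerProductSpace ℂ E]
    [CompleteSpace E] (v : unitary (E →L[ℂ] E)) (x : E) : ‖(v : E →L[ℂ] E) x‖ = ‖x‖ :=
  (Unitary.linearIsometryEquiv v).norm_map x

/-- Representations compatible with `π` on large enough finite-dimensional subspaces agree with
`π` on a given group element and a given vector. -/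
theorem exists_finiteDimensional_apply_eq (π : FreeGroup (Fin n) →* unitary (K →L[ℂ] K))
    (g : FreeGroup (Fin n)) (x : K) :
    ∃ F₀ : Submodule ℂ K, FiniteDimensional ℂ F₀ ∧ ∀ F : Submodule ℂ K, F₀ ≤ F →
      ∀ [FiniteDimensional ℂ F] (ρ : FreeGroup (Fin n) →* unitary (F →L[ℂ] F)),
      IsCompatible π F ρ → ∃ hx : x ∈ F,
        ((ρ g : F →L[ℂ] F) ⟨x, hx⟩ : K) = (π g : K →L[ℂ] K) x := by
  induction g using FreeGroup.induction_on generalizing x with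
  | C1 =>
    refine ⟨ℂ ∙ x, inferInstance, fun F hF _ ρ hρ =>
      ⟨hF (Submodule.mem_span_singleton_self x), ?_⟩⟩
    rw [map_one, map_one]
    rfl
  | of i =>
    refine ⟨Submodule.span ℂ {x, (π (FreeGroup.of i) : K →L[ℂ] K) x},
      FiniteDimensional.span_of_finite ℂ (Set.toFinite _), fun F hF _ ρ hρ => ?_⟩
    exact ⟨hF (Submodule.subset_span (by simp)), hρ i _ (hF (Submodule.subset_span (by simp)))⟩
  | inv_of i _ =>
    set z := (π (FreeGroup.of i)⁻¹ : K →L[ℂ] K) x with hz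
    have hπz : (π (FreeGroup.of i) : K →L[ℂ] K) z = x := by
      rw [hz, map_inv, unitary_apply_inv_apply]
    refine ⟨Submodule.span ℂ {x, z},
      FiniteDimensional.span_of_finite ℂ (Set.toFinite _), fun F hF _ ρ hρ => ?_⟩
    have hx : x ∈ F := hF (Submodule.subset_span (by simp))
    have hzF : z ∈ F := hF (Submodule.subset_span (by simp))
    refine ⟨hx, ?_⟩
    have h1 : (ρ (FreeGroup.of i) : F →L[ℂ] F) ⟨z, hzF⟩ = ⟨x, hx⟩ := by
      apply Subtype.ext
      rw [hρ i ⟨z, hzF⟩ (by rw [hπz]; exact hx), hπz]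
    rw [← h1, map_inv, unitary_inv_apply_apply]
  | mul g h hg hh =>
    obtain ⟨F₁, h1, hF₁⟩ := hh x
    obtain ⟨F₂, h2, hF₂⟩ := hg ((π h : K →L[ℂ] K) x)
    refine ⟨F₁ ⊔ F₂, inferInstance, fun F hF _ ρ hρ => ?_⟩
    obtain ⟨hx, ex⟩ := hF₁ F (le_sup_left.trans hF) ρ hρ
    obtain ⟨hy, ey⟩ := hF₂ F (le_sup_right.trans hF) ρ hρ
    refine ⟨hx, ?_⟩
    have h3 : (ρ h : F →L[ℂ] F) ⟨x, hx⟩ = ⟨_, hy⟩ := Subtype.ext ex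
    rw [map_mul, map_mul, Submonoid.coe_mul, Submonoid.coe_mul, mul_apply_eq_comp,
      mul_apply_eq_comp, h3, ey]

theorem exists_finiteDimensional_integrated_apply_eq
    (π : FreeGroup (Fin n) →* unitary (K →L[ℂ] K)) (a : GroupAlg (FreeGroup (Fin n))) (x : K) :
    ∃ F₀ : Submodule ℂ K, FiniteDimensional ℂ F₀ ∧ ∀ F : Submodule ℂ K, F₀ ≤ F →
      ∀ [FiniteDimensional ℂ F] (ρ : FreeGroup (Fin n) →* unitary (F →L[ℂ] F)),
      IsCompatible π F ρ → ∃ hx : x ∈ F, (integrated ρ a ⟨x, hx⟩ : K) = integrated π a x := by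
  induction a using GroupAlg.induction with
  | h0 =>
    refine ⟨ℂ ∙ x, inferInstance, fun F hF _ ρ hρ =>
      ⟨hF (Submodule.mem_span_singleton_self x), by simp⟩⟩
  | hadd a b ha hb =>
    obtain ⟨F₁, h1, hF₁⟩ := ha
    obtain ⟨F₂, h2, hF₂⟩ := hb
    refine ⟨F₁ ⊔ F₂, inferInstance, fun F hF _ ρ hρ => ?_⟩
    obtain ⟨hx, ex⟩ := hF₁ F (le_sup_left.trans hF) ρ hρ
    obtain ⟨hy, ey⟩ := hF₂ F (le_sup_right.trans hF) ρ hρ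
    refine ⟨hx, ?_⟩
    rw [map_add, map_add, add_apply, add_apply, ← ex, ← ey]
    rfl
  | hs g c =>
    obtain ⟨F₁, h1, hF₁⟩ := exists_finiteDimensional_apply_eq π g x
    refine ⟨F₁, h1, fun F hF _ ρ hρ => ?_⟩
    obtain ⟨hx, ex⟩ := hF₁ F hF ρ hρ
    refine ⟨hx, ?_⟩
    rw [integrated_single, integrated_single, smul_apply,
      smul_apply, ← ex]
    rfl

end Compression

/-! ### Lattice bijections close to a measure-preserving linear map -/

section Lattice

open MeasureTheory

variable {ι : Type*} [Fintype ι]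

theorem volume_floor_fiber (p : ι → ℤ) :
    volume {x : ι → ℝ | (fun i => ⌊x i⌋) = p} = 1 := by
  have : {x : ι → ℝ | (fun i => ⌊x i⌋) = p} =
      Set.pi Set.univ fun i => Set.Ico (p i : ℝ) (p i + 1) := by
    ext x
    simp [funext_iff, Int.floor_eq_iff]
  rw [this, Real.volume_pi_Ico]
  simp

theorem volume_floor_preimage (S : Finset (ι → ℤ)) :
    volume {x : ι → ℝ | (fun i => ⌊x i⌋) ∈ S} = S.card := by
  have h : {x : ι → ℝ | (fun i => ⌊x i⌋) ∈ S} =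
      ⋃ p ∈ S, {x : ι → ℝ | (fun i => ⌊x i⌋) = p} := by
    ext x
    simp
  have hm : Measurable fun x : ι → ℝ => fun i => ⌊x i⌋ := by fun_prop
  rw [h, measure_biUnion_finset]
  · simp [volume_floor_fiber]
  · intro p _ q _ hpq
    refine Set.disjoint_left.2 fun x hx hx' => hpq ?_
    exact hx.symm.trans hx'
  · intro p _
    exact hm (measurableSet_singleton p)

/-- Hall's theorem, applied to the relation "the image of the unit cube at `p` meets the unit cube
at `q`"; comparing volumes gives Hall's condition. -/
theorem exists_injective_lattice_close (A : (ι → ℝ) →L[ℝ] (ι → ℝ))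
    (hA : MeasurePreserving A) :
    ∃ C : ℝ, ∃ f : (ι → ℤ) → (ι → ℤ), Function.Injective f ∧
      ∀ p i, |(f p i : ℝ) - A (fun j => (p j : ℝ)) i| ≤ C := by
  classical
  let cst : (ι → ℤ) → (ι → ℝ) := fun p j => (p j : ℝ)
  -- `t p` contains every `q` whose unit cube meets the image of the unit cube at `p`: the first
  -- has diameter `1`, the second at most `‖A‖` in the sup norm
  let t : (ι → ℤ) → Finset (ι → ℤ) := fun p => Fintype.piFinset fun i =>
    Finset.Icc ⌈A (cst p) i - (‖A‖ + 1)⌉ ⌊A (cst p) i + (‖A‖ + 1)⌋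
  have hmem : ∀ x : ι → ℝ, (fun i => ⌊A x i⌋) ∈ t fun i => ⌊x i⌋ := by
    intro x
    rw [Fintype.mem_piFinset]
    intro i
    have h1 : ‖x - cst fun i => ⌊x i⌋‖ ≤ 1 := by
      rw [pi_norm_le_iff_of_nonneg zero_le_one]
      intro j
      rw [Real.norm_eq_abs, Pi.sub_apply, Int.self_sub_floor, Int.abs_fract]
      exact (Int.fract_lt_one _).le
    have h2 : |A x i - A (cst fun i => ⌊x i⌋) i| ≤ ‖A‖ := by
      rw [← Real.norm_eq_abs, ← Pi.sub_apply, ← map_sub]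
      exact (norm_le_pi_norm _ i).trans ((A.le_opNorm _).trans
        (mul_le_of_le_one_right (norm_nonneg _) h1))
    rw [abs_le] at h2
    rw [Finset.mem_Icc, Int.ceil_le, Int.le_floor]
    constructor
    · linarith [Int.lt_floor_add_one (A x i)]
    · linarith [Int.floor_le (A x i)]
  have hall : ∀ S : Finset (ι → ℤ), S.card ≤ (S.biUnion t).card := by
    intro S
    have hm : Measurable fun x : ι → ℝ => fun i => ⌊x i⌋ := by fun_prop
    have h1 : {x : ι → ℝ | (fun i => ⌊x i⌋) ∈ S} ⊆
        A ⁻¹' {x : ι → ℝ | (fun i => ⌊x i⌋) ∈ S.biUnion t} := fun x hx =>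
      Finset.mem_biUnion.2 ⟨_, hx, hmem x⟩
    have h2 := measure_mono (μ := volume) h1
    have h3 : MeasurableSet {x : ι → ℝ | (fun i => ⌊x i⌋) ∈ S.biUnion t} :=
      hm (S.biUnion t).finite_toSet.measurableSet
    rw [hA.measure_preimage h3.nullMeasurableSet,
      volume_floor_preimage, volume_floor_preimage] at h2
    exact_mod_cast h2
  obtain ⟨f, hf, hft⟩ := (Finset.all_card_le_biUnion_card_iff_exists_injective t).1 hall
  refine ⟨‖A‖ + 1, f, hf, fun p i => ?_⟩
  have := Fintype.mem_piFinset.1 (hft p) i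
  rw [Finset.mem_Icc, Int.ceil_le, Int.le_floor] at this
  rw [abs_le]
  constructor <;> linarith [this.1, this.2]

/-- The injections obtained for `A` and for its inverse combine to a bijection by the
Schröder–Bernstein theorem, whose bijection agrees at each point with one of the two. -/
theorem exists_perm_lattice_close (A : (ι → ℝ) ≃L[ℝ] (ι → ℝ))
    (hA : MeasurePreserving A) (hA' : MeasurePreserving A.symm) :
    ∃ C : ℝ, ∃ σ : Equiv.Perm (ι → ℤ),
      ∀ p i, |(σ p i : ℝ) - A (fun j => (p j : ℝ)) i| ≤ C := by
  obtain ⟨C, f, hf, hfC⟩ := exists_injective_lattice_close (A : (ι → ℝ) →L[ℝ] (ι → ℝ)) hA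
  obtain ⟨D, g, hg, hgD⟩ := exists_injective_lattice_close (A.symm : (ι → ℝ) →L[ℝ] (ι → ℝ)) hA'
  let E : ℝ := max C (‖(A : (ι → ℝ) →L[ℝ] (ι → ℝ))‖ * max D 0)
  obtain ⟨h, hb, hE⟩ := Function.Embedding.schroeder_bernstein_of_rel hf hg
    (fun p q => ∀ i, |(q i : ℝ) - A (fun j => (p j : ℝ)) i| ≤ E)
    (fun p i => (hfC p i).trans (le_max_left _ _)) fun q i => by
      refine le_trans ?_ (le_max_right _ _)
      have h1 : ‖A.symm (fun j => (q j : ℝ)) - fun j => (g q j : ℝ)‖ ≤ max D 0 := by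
        rw [pi_norm_le_iff_of_nonneg (le_max_right _ _)]
        intro j
        rw [Real.norm_eq_abs, Pi.sub_apply, abs_sub_comm]
        exact (hgD q j).trans (le_max_left _ _)
      have h2 := ((A : (ι → ℝ) →L[ℝ] (ι → ℝ)).le_opNorm_of_le h1)
      refine le_trans ?_ ((norm_le_pi_norm _ i).trans h2)
      simp
  exact ⟨E, Equiv.ofBijective h hb, hE⟩

/-- A linear isometry of Euclidean space is within bounded distance of a bijection of the integer
lattice. -/
theorem exists_perm_lattice_close_isometry
    (U : EuclideanSpace ℝ ι ≃ₗᵢ[ℝ] EuclideanSpace ℝ ι) :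
    ∃ C : ℝ, ∃ σ : Equiv.Perm (ι → ℤ), ∀ p,
      ‖(WithLp.toLp 2 fun i => (σ p i : ℝ)) - U (WithLp.toLp 2 fun i => (p i : ℝ))‖ ≤ C := by
  let T : EuclideanSpace ℝ ι ≃L[ℝ] (ι → ℝ) := PiLp.continuousLinearEquiv 2 ℝ fun _ : ι => ℝ
  let A : (ι → ℝ) ≃L[ℝ] (ι → ℝ) :=
    (T.symm.trans U.toContinuousLinearEquiv).trans T
  have key : ∀ W : EuclideanSpace ℝ ι ≃ₗᵢ[ℝ] EuclideanSpace ℝ ι,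
      MeasurePreserving fun x : ι → ℝ => (W (WithLp.toLp 2 x)).ofLp := fun W =>
    ((PiLp.volume_preserving_ofLp ι).comp W.measurePreserving).comp
      (PiLp.volume_preserving_toLp ι)
  obtain ⟨C, σ, hσ⟩ := exists_perm_lattice_close A (key U) (key U.symm)
  refine ⟨‖(T.symm : (ι → ℝ) →L[ℝ] EuclideanSpace ℝ ι)‖ * max C 0, σ, fun p => ?_⟩
  have h1 : ‖(fun i => (σ p i : ℝ)) - A (fun j => (p j : ℝ))‖ ≤ max C 0 := by
    rw [pi_norm_le_iff_of_nonneg (le_max_right _ _)]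
    exact fun j => (hσ p j).trans (le_max_left _ _)
  have h2 := (T.symm : (ι → ℝ) →L[ℝ] EuclideanSpace ℝ ι).le_opNorm_of_le h1
  exact h2

end Lattice

/-! ### Tent-weighted lattice sums -/

section Tent

/-- The vector field `x ↦ (R - ‖x‖)⁺ x`. -/
noncomputable def tent {E : Type*} [NormedAddCommGroup E] [NormedSpace ℝ E] (R : ℝ) (x : E) : E :=
  max 0 (R - ‖x‖) • x

variable {E : Type*} [NormedAddCommGroup E] [NormedSpace ℝ E]

theorem tent_eq_zero {R : ℝ} {x : E} (h : R ≤ ‖x‖) : tent R x = 0 := by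
  rw [tent, max_eq_left (by linarith), zero_smul]

theorem map_tent {E' : Type*} [NormedAddCommGroup E'] [NormedSpace ℝ E'] (U : E ≃ₗᵢ[ℝ] E')
    (R : ℝ) (x : E) : U (tent R x) = tent R (U x) := by
  rw [tent, tent, map_smul, U.norm_map]

theorem norm_tent_sub_tent_le {R : ℝ} (hR : 0 ≤ R) (x y : E) :
    ‖tent R x - tent R y‖ ≤ 2 * R * ‖x - y‖ := by
  wlog hxy : ‖y‖ ≤ ‖x‖ generalizing x y
  · rw [norm_sub_rev, norm_sub_rev x]
    exact this y x (le_of_not_ge hxy)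
  rcases le_total R ‖y‖ with hy | hy
  · rw [tent_eq_zero hy, tent_eq_zero (hy.trans hxy), sub_zero, norm_zero]
    positivity
  · have h1 : tent R x - tent R y =
        max 0 (R - ‖x‖) • (x - y) + (max 0 (R - ‖x‖) - max 0 (R - ‖y‖)) • y := by
      simp only [tent]
      module
    have h2 : |max 0 (R - ‖x‖) - max 0 (R - ‖y‖)| ≤ ‖x - y‖ := by
      rw [max_comm 0, max_comm 0]
      refine (abs_max_sub_max_le_abs _ _ _).trans ?_
      rw [sub_sub_sub_cancel_left, norm_sub_rev]
      exact abs_norm_sub_norm_le y x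
    have h3 : |max 0 (R - ‖x‖)| ≤ R := by
      rw [abs_of_nonneg (le_max_left _ _)]
      exact max_le hR (by linarith [norm_nonneg x])
    rw [h1]
    refine (norm_add_le _ _).trans ?_
    rw [norm_smul, norm_smul, Real.norm_eq_abs, Real.norm_eq_abs]
    calc _ ≤ R * ‖x - y‖ + ‖x - y‖ * R := by gcongr
      _ = _ := by ring

variable {ι : Type*}

/-- An integer vector, as a point of Euclidean space. -/
noncomputable def latticePoint (p : ι → ℤ) : EuclideanSpace ℝ ι := WithLp.toLp 2 fun i => (p i : ℝ)

theorem latticePoint_apply (p : ι → ℤ) (i : ι) : latticePoint p i = p i := rfl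

variable [Fintype ι]

theorem norm_latticePoint_sq (p : ι → ℤ) : ‖latticePoint p‖ ^ 2 = ∑ i, (p i : ℝ) ^ 2 := by
  simp [EuclideanSpace.norm_sq_eq, latticePoint_apply]

theorem norm_tent_sq (R : ℝ) (p : ι → ℤ) : ‖tent R (latticePoint p)‖ ^ 2 =
    ∑ i, max 0 (R - ‖latticePoint p‖) ^ 2 * ((p i : ℝ) * p i) := by
  rw [tent, norm_smul, mul_pow, norm_latticePoint_sq, Real.norm_eq_abs, sq_abs, Finset.mul_sum]
  simp only [sq]

variable [DecidableEq ι]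

/-- The integer vectors with coordinates of absolute value at most `N`. -/
noncomputable def latticeBox (ι : Type*) [Fintype ι] [DecidableEq ι] (N : ℕ) : Finset (ι → ℤ) :=
  Fintype.piFinset fun _ => Finset.Icc (-N : ℤ) N

theorem mem_latticeBox {N : ℕ} {p : ι → ℤ} : p ∈ latticeBox ι N ↔ ∀ i, |p i| ≤ N := by
  simp [latticeBox, abs_le]

theorem card_latticeBox (N : ℕ) : (latticeBox ι N).card = (2 * N + 1) ^ Fintype.card ι := by
  rw [latticeBox, Fintype.card_piFinset, Finset.prod_const, Int.card_Icc, Finset.card_univ]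
  congr 1
  omega

theorem mem_latticeBox_of_norm_le {N : ℕ} {p : ι → ℤ} (h : ‖latticePoint p‖ ≤ N) :
    p ∈ latticeBox ι N := by
  rw [mem_latticeBox]
  intro i
  have := (PiLp.norm_apply_le (latticePoint p) i).trans h
  rw [latticePoint_apply, Real.norm_eq_abs] at this
  exact_mod_cast this

theorem sum_latticeBox_mul_eq_zero (R : ℝ) (N : ℕ) {i j : ι} (hij : i ≠ j) :
    ∑ p ∈ latticeBox ι N, max 0 (R - ‖latticePoint p‖) ^ 2 * ((p i : ℝ) * p j) = 0 := by
  -- the reflection in the `i`-th coordinate changes the sign of every term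
  let flip : Equiv.Perm (ι → ℤ) := Equiv.piCongrRight fun k =>
    if k = i then Equiv.neg ℤ else Equiv.refl ℤ
  have hflip : ∀ p k, flip p k = if k = i then -p k else p k := fun p k => by
    simp only [flip, Equiv.piCongrRight_apply, Pi.map_apply]
    split_ifs <;> rfl
  have hnorm : ∀ p, ‖latticePoint (flip p)‖ = ‖latticePoint p‖ := fun p => by
    rw [← sq_eq_sq₀ (norm_nonneg _) (norm_nonneg _), norm_latticePoint_sq, norm_latticePoint_sq]
    refine Finset.sum_congr rfl fun k _ => ?_
    rw [hflip]
    split_ifs <;> simp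
  have := Finset.sum_equiv (s := latticeBox ι N) (t := latticeBox ι N) flip
    (f := fun p => -(max 0 (R - ‖latticePoint p‖) ^ 2 * ((p i : ℝ) * p j)))
    (g := fun p => max 0 (R - ‖latticePoint p‖) ^ 2 * ((p i : ℝ) * p j))
    (fun p => by
      rw [mem_latticeBox, mem_latticeBox]
      refine forall_congr' fun k => ?_
      rw [hflip]
      split_ifs <;> simp)
    (fun p _ => by
      rw [hnorm, hflip, hflip, if_pos rfl, if_neg hij.symm]
      push_cast
      ring)
  rw [Finset.sum_neg_distrib] at this
  linarith

theorem sum_latticeBox_sq_eq (R : ℝ) (N : ℕ) (i j : ι) :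
    ∑ p ∈ latticeBox ι N, max 0 (R - ‖latticePoint p‖) ^ 2 * ((p i : ℝ) * p i) =
      ∑ p ∈ latticeBox ι N, max 0 (R - ‖latticePoint p‖) ^ 2 * ((p j : ℝ) * p j) := by
  let s : Equiv.Perm (ι → ℤ) := (Equiv.swap i j).arrowCongr (Equiv.refl ℤ)
  have hs : ∀ p k, s p k = p (Equiv.swap i j k) := fun p k => by simp [s, Equiv.arrowCongr]
  have hnorm : ∀ p, ‖latticePoint (s p)‖ = ‖latticePoint p‖ := fun p => by
    rw [← sq_eq_sq₀ (norm_nonneg _) (norm_nonneg _), norm_latticePoint_sq, norm_latticePoint_sq]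
    simp only [hs]
    exact Equiv.sum_comp (Equiv.swap i j) fun k => (p k : ℝ) ^ 2
  refine Finset.sum_equiv s (fun p => ?_) fun p _ => ?_
  · rw [mem_latticeBox, mem_latticeBox]
    simp only [hs]
    exact ((Equiv.swap i j).forall_congr_right (q := fun k => |p k| ≤ N)).symm
  · rw [hnorm, hs, Equiv.swap_apply_right]

/-- By the symmetries of the lattice, the vectors `tent R (latticePoint p)` form a tight frame. -/
theorem sum_inner_tent_sq (R : ℝ) (N : ℕ) (x : EuclideanSpace ℝ ι) :
    Fintype.card ι * ∑ p ∈ latticeBox ι N, ⟪tent R (latticePoint p), x⟫_ℝ ^ 2 =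
      (∑ p ∈ latticeBox ι N, ‖tent R (latticePoint p)‖ ^ 2) * ‖x‖ ^ 2 := by
  let S : ι → ι → ℝ := fun i j =>
    ∑ p ∈ latticeBox ι N, max 0 (R - ‖latticePoint p‖) ^ 2 * ((p i : ℝ) * p j)
  have h1 : ∑ p ∈ latticeBox ι N, ⟪tent R (latticePoint p), x⟫_ℝ ^ 2 =
      ∑ i, ∑ j, x i * x j * S i j := by
    have : ∀ p ∈ latticeBox ι N, ⟪tent R (latticePoint p), x⟫_ℝ ^ 2 = ∑ i, ∑ j,
        x i * x j * (max 0 (R - ‖latticePoint p‖) ^ 2 * ((p i : ℝ) * p j)) := by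
      intro p _
      rw [tent, real_inner_smul_left, mul_pow, PiLp.inner_apply, sq (∑ i, _),
        Finset.sum_mul_sum, Finset.mul_sum]
      refine Finset.sum_congr rfl fun i _ => ?_
      rw [Finset.mul_sum]
      refine Finset.sum_congr rfl fun j _ => ?_
      simp only [latticePoint_apply, RCLike.inner_apply, conj_trivial]
      ring
    rw [Finset.sum_congr rfl this, Finset.sum_comm]
    refine Finset.sum_congr rfl fun i _ => ?_
    rw [Finset.sum_comm]
    refine Finset.sum_congr rfl fun j _ => ?_
    rw [Finset.mul_sum]
  have h2 : ∑ p ∈ latticeBox ι N, ‖tent R (latticePoint p)‖ ^ 2 = ∑ i, S i i := by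
    simp only [norm_tent_sq]
    exact Finset.sum_comm
  have h3 : ∀ i, ∑ j, x i * x j * S i j = x i ^ 2 * S i i := fun i => by
    rw [Finset.sum_eq_single i]
    · ring
    · intro j _ hj
      simp only [S]
      rw [sum_latticeBox_mul_eq_zero R N hj.symm, mul_zero]
    · simp
  have h4 : ∀ i, ∑ j, S j j = Fintype.card ι * S i i := fun i => by
    rw [Finset.sum_congr rfl fun j _ => sum_latticeBox_sq_eq R N j i, Finset.sum_const,
      nsmul_eq_mul, Finset.card_univ]
  rw [h1, h2, EuclideanSpace.norm_sq_eq, Finset.mul_sum, Finset.mul_sum]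
  refine Finset.sum_congr rfl fun i _ => ?_
  rw [h3, h4 i, Real.norm_eq_abs, sq_abs]
  ring

/-- The tent field of radius `R` on the lattice has total energy of order `R ^ (d + 4)`, while a
bounded displacement of the lattice points changes it by an energy of order `R ^ (d + 2)` only. -/
theorem exists_tent_energy [Nonempty ι] (C : ℕ) {ε : ℝ} (hε : 0 < ε) :
    ∃ (R : ℝ) (N : ℕ), 0 ≤ R ∧ R + C ≤ N ∧
      0 < ∑ p ∈ latticeBox ι N, ‖tent R (latticePoint p)‖ ^ 2 ∧
      (latticeBox ι N).card * (2 * R * C) ^ 2 ≤ ε ^ 2 *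
        ((∑ p ∈ latticeBox ι N, ‖tent R (latticePoint p)‖ ^ 2) * 2 / Fintype.card ι) := by
  set d := Fintype.card ι with hd
  have hd0 : 0 < d := Fintype.card_pos
  let K : ℕ := 8 * d + 2 * C + 1
  obtain ⟨m, hm⟩ := exists_nat_ge (max 1 ((K : ℝ) ^ d * 8 * C ^ 2 * d / ε ^ 2))
  have hm1 : (1 : ℝ) ≤ m := (le_max_left _ _).trans hm
  have hm2 : (K : ℝ) ^ d * 8 * C ^ 2 * d ≤ ε ^ 2 * m := by
    have := (le_max_right _ _).trans hm
    rwa [div_le_iff₀' (by positivity)] at this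
  have hd1 : (1 : ℝ) ≤ d := by exact_mod_cast hd0
  -- the vectors with all coordinates in `[m, 2m)` have norm at least `m` and at most `R / 2`, so
  -- that each of them contributes energy of order `m ^ 4`
  set R : ℝ := 4 * d * m with hR
  set N : ℕ := 4 * d * m + C with hN
  have hRN : R + C ≤ N := by rw [hR, hN]; push_cast; exact le_rfl
  let A : Finset (ι → ℤ) := Fintype.piFinset fun _ => Finset.Ico (m : ℤ) (2 * m)
  have hA : ∀ p ∈ A, ∀ i, (m : ℝ) ≤ p i ∧ (p i : ℝ) ≤ 2 * m := by
    intro p hp i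
    have := Finset.mem_Ico.1 (Fintype.mem_piFinset.1 hp i)
    exact ⟨by exact_mod_cast this.1, by exact_mod_cast this.2.le⟩
  have hAcard : A.card = m ^ d := by
    rw [Fintype.card_piFinset, Finset.prod_const, Int.card_Ico, Finset.card_univ]
    congr 1
    omega
  have hup : ∀ p ∈ A, ‖latticePoint p‖ ≤ 2 * d * m := by
    intro p hp
    refine (sq_le_sq₀ (norm_nonneg _) (by positivity)).1 ?_
    rw [norm_latticePoint_sq]
    calc ∑ i, (p i : ℝ) ^ 2 ≤ ∑ _i : ι, (2 * m : ℝ) ^ 2 := by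
          refine Finset.sum_le_sum fun i _ => ?_
          have := hA p hp i
          exact pow_le_pow_left₀ (by linarith) this.2 2
      _ = d * (2 * m : ℝ) ^ 2 := by rw [Finset.sum_const, nsmul_eq_mul, Finset.card_univ]
      _ ≤ (d * d) * (2 * m : ℝ) ^ 2 := by gcongr; nlinarith
      _ = (2 * d * m) ^ 2 := by ring
  have hlow : ∀ p ∈ A, (m : ℝ) ≤ ‖latticePoint p‖ := by
    intro p hp
    obtain ⟨i⟩ := ‹Nonempty ι›
    refine (hA p hp i).1.trans ((le_abs_self _).trans ?_)
    exact PiLp.norm_apply_le (latticePoint p) i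
  have hsub : A ⊆ latticeBox ι N := by
    intro p hp
    refine mem_latticeBox_of_norm_le ((hup p hp).trans (le_trans ?_ hRN))
    rw [hR]
    have : (0 : ℝ) ≤ C := by positivity
    nlinarith
  have henergy : (m : ℝ) ^ d * (4 * d ^ 2 * m ^ 4) ≤
      ∑ p ∈ latticeBox ι N, ‖tent R (latticePoint p)‖ ^ 2 := by
    refine le_trans ?_ (Finset.sum_le_sum_of_subset_of_nonneg hsub fun _ _ _ => by positivity)
    have : ∀ p ∈ A, (4 * d ^ 2 * m ^ 4 : ℝ) ≤ ‖tent R (latticePoint p)‖ ^ 2 := by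
      intro p hp
      have h1 : (2 * d * m : ℝ) ≤ max 0 (R - ‖latticePoint p‖) := by
        refine le_trans ?_ (le_max_right _ _)
        rw [hR]
        linarith [hup p hp]
      rw [tent, norm_smul, Real.norm_eq_abs, abs_of_nonneg (le_max_left _ _), mul_pow]
      calc (4 * d ^ 2 * m ^ 4 : ℝ) = (2 * d * m) ^ 2 * m ^ 2 := by ring
        _ ≤ _ := by
          gcongr
          exact hlow p hp
    have := Finset.card_nsmul_le_sum A _ _ this
    rw [hAcard, nsmul_eq_mul] at this
    exact_mod_cast this
  refine ⟨R, N, by positivity, hRN, lt_of_lt_of_le (by positivity) henergy, ?_⟩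
  have hcard : ((latticeBox ι N).card : ℝ) ≤ (K : ℝ) ^ d * (m : ℝ) ^ d := by
    rw [card_latticeBox, ← mul_pow]
    push_cast
    gcongr
    simp only [K, hN]
    push_cast
    nlinarith
  calc ((latticeBox ι N).card : ℝ) * (2 * R * C) ^ 2
      ≤ ((K : ℝ) ^ d * (m : ℝ) ^ d) * (2 * R * C) ^ 2 := by gcongr
    _ = ((K : ℝ) ^ d * 8 * C ^ 2 * d) * ((m : ℝ) ^ d * (8 * d * m ^ 2)) := by rw [hR]; ring
    _ ≤ (ε ^ 2 * m) * ((m : ℝ) ^ d * (8 * d * m ^ 2)) := by gcongr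
    _ ≤ (ε ^ 2 * m) * ((m : ℝ) ^ d * (8 * d * m ^ 2)) * m :=
        le_mul_of_one_le_right (by positivity) hm1
    _ = ε ^ 2 * (((m : ℝ) ^ d * (4 * d ^ 2 * m ^ 4)) * 2 / d) := by field_simp; ring
    _ ≤ _ := by gcongr

end Tent

/-! ### Approximate intertwiners -/

section Intertwiner

open MatrixFinite

variable {H : Type*} [NormedAddCommGroup H] [InnerProductSpace ℂ H] [CompleteSpace H]

theorem norm_sum_smul_basis_sq {H : Type*} [NormedAddCommGroup H] [InnerProductSpace ℂ H]
    {Λ : Type*} (e : HilbertBasis ℕ ℂ H) {B : Finset Λ} {y : Λ → ℕ}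
    (hy : Set.InjOn y B) (c : Λ → ℂ) :
    ‖∑ p ∈ B, c p • e (y p)‖ ^ 2 = ∑ p ∈ B, ‖c p‖ ^ 2 := by
  have ho : Orthonormal ℂ fun p : B => e (y p) :=
    e.orthonormal.comp (fun p : B => y p) fun p q h => Subtype.ext (hy p.2 q.2 h)
  rw [← Finset.sum_coe_sort, ← Finset.sum_coe_sort B, ← inner_self_eq_norm_sq (𝕜 := ℂ),
    ho.inner_sum]
  simp [← Complex.normSq_eq_norm_sq, Complex.normSq_apply]

theorem norm_inner_sq_eq_re {F : Type*} [NormedAddCommGroup F] [InnerProductSpace ℂ F]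
    (v x : F) : ‖⟪v, x⟫_ℂ‖ ^ 2 = (⟪v, x⟫_ℂ).re ^ 2 + (⟪v, (-Complex.I) • x⟫_ℂ).re ^ 2 := by
  rw [inner_smul_right, ← Complex.normSq_eq_norm_sq, Complex.normSq_apply]
  simp
  ring

/-- Any tuple of unitaries of a finite-dimensional space `F` is approximately the restriction of
the permutation unitaries of a universal tuple to an isometric copy of `F`. The vector `x` is sent
to the function `p ↦ ⟪g p, x⟫` on the lattice spanned by a real orthonormal basis, where `g` is the
tent field of large radius, and the unitaries are discretized to bijections of the lattice. -/
theorem exists_approx_intertwiner (e : HilbertBasis ℕ ℂ H) {n : ℕ} {θ : Fin n → Equiv.Perm ℕ}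
    (hθ : IsUniversalTuple θ) {F : Type*} [NormedAddCommGroup F] [InnerProductSpace ℂ F]
    [FiniteDimensional ℂ F] [Nontrivial F] (u : Fin n → F ≃ₗᵢ[ℂ] F) {ε : ℝ} (hε : 0 < ε) :
    ∃ V : F →ₗᵢ[ℂ] H, ∀ i x,
      ‖(permUnitary e (θ i) : H →L[ℂ] H) (V x) - V (u i x)‖ ≤ ε * ‖x‖ := by
  classical
  let _ : InnerProductSpace ℝ F := InnerProductSpace.rclikeToReal ℂ F
  have : FiniteDimensional ℝ F := FiniteDimensional.complexToReal F
  let d := Module.finrank ℝ F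
  have hd : 0 < d := Module.finrank_pos
  have : Nonempty (Fin d) := ⟨⟨0, hd⟩⟩
  let β : F ≃ₗᵢ[ℝ] EuclideanSpace ℝ (Fin d) := (stdOrthonormalBasis ℝ F).repr
  let uR : Fin n → F ≃ₗᵢ[ℝ] F := fun i =>
    { (u i).toLinearEquiv.restrictScalars ℝ with norm_map' := (u i).norm_map }
  -- the unitaries, as rotations of `ℝᵈ` in the coordinates `β`
  let U : Fin n → EuclideanSpace ℝ (Fin d) ≃ₗᵢ[ℝ] EuclideanSpace ℝ (Fin d) := fun i =>
    (β.symm.trans (uR i)).trans β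
  choose C₀ σ hσ using fun i => exists_perm_lattice_close_isometry (U i)
  obtain ⟨C, hC⟩ : ∃ C : ℕ, ∀ i p,
      ‖latticePoint (σ i p) - U i (latticePoint p)‖ ≤ C := by
    obtain ⟨C, hC⟩ := (Set.finite_range C₀).bddAbove
    obtain ⟨C', hC'⟩ := exists_nat_ge C
    exact ⟨C', fun i p => (hσ i p).trans ((hC ⟨i, rfl⟩).trans hC')⟩
  obtain ⟨R, N, hR, hRN, hQ, hbound⟩ := exists_tent_energy (ι := Fin d) C hε
  set B := latticeBox (Fin d) N with hB
  set Q := ∑ p ∈ B, ‖tent R (latticePoint p)‖ ^ 2 with hQdef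
  rw [Fintype.card_fin] at hbound
  obtain ⟨y, hyσ, hyB, hy⟩ := hθ (Fin d → ℤ) B σ
  let g : (Fin d → ℤ) → F := fun p => β.symm (tent R (latticePoint p))
  have hd' : (0 : ℝ) < d := by exact_mod_cast hd
  set c : ℝ := √(Q * 2 / d) with hc
  have hc0 : 0 < c := Real.sqrt_pos.2 (by positivity)
  have hc2 : c ^ 2 = Q * 2 / d := Real.sq_sqrt (by positivity)
  let T : F →ₗ[ℂ] H := ∑ p ∈ B, (innerₛₗ ℂ (g p)).smulRight (e (y p))
  have hT : ∀ x, T x = ∑ p ∈ B, ⟪g p, x⟫_ℂ • e (y p) := fun x => by simp [T]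
  have hreal : ∀ x : F, d * ∑ p ∈ B, (⟪g p, x⟫_ℂ).re ^ 2 = Q * ‖x‖ ^ 2 := by
    intro x
    have h := sum_inner_tent_sq R N (β x)
    rw [Fintype.card_fin, β.norm_map] at h
    rw [← h]
    congr 1
    refine Finset.sum_congr rfl fun p _ => ?_
    have h1 : (⟪g p, x⟫_ℂ).re = ⟪g p, x⟫_ℝ := rfl
    rw [h1, ← β.inner_map_map, β.apply_symm_apply]
  have hTnorm : ∀ x, ‖T x‖ = c * ‖x‖ := by
    intro x
    rw [← sq_eq_sq₀ (norm_nonneg _) (by positivity), mul_pow, hc2, hT,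
      norm_sum_smul_basis_sq e hyB]
    simp only [norm_inner_sq_eq_re]
    rw [Finset.sum_add_distrib]
    -- real and imaginary part of the inner product contribute equally
    have h1 := hreal x
    have h2 := hreal ((-Complex.I) • x)
    rw [norm_smul, norm_neg, Complex.norm_I, one_mul] at h2
    field_simp
    linarith
  refine ⟨{ toLinearMap := (c⁻¹ : ℂ) • T, norm_map' := fun x => ?_ }, fun i x => ?_⟩
  · rw [LinearMap.smul_apply, norm_smul, hTnorm, norm_inv, Complex.norm_real, Real.norm_eq_abs,
      abs_of_pos hc0, inv_mul_cancel_left₀ hc0.ne']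
  change ‖(permUnitary e (θ i) : H →L[ℂ] H) ((c⁻¹ : ℂ) • T x) - (c⁻¹ : ℂ) • T (u i x)‖ ≤ _
  have h1 : (permUnitary e (θ i) : H →L[ℂ] H) (T x) =
      ∑ p ∈ B, ⟪g p, x⟫_ℂ • e (y (σ i p)) := by
    rw [hT, map_sum]
    refine Finset.sum_congr rfl fun p hp => ?_
    rw [map_smul, permUnitary_apply, hy i p hp]
  -- the box is so large that outside it neither `g` nor `g ∘ σ i` is supported
  have h2 : T (u i x) = ∑ p ∈ B, ⟪g (σ i p), u i x⟫_ℂ • e (y (σ i p)) := by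
    rw [hT]
    have hg : ∀ p, ⟪g p, u i x⟫_ℂ • e (y p) ≠ 0 → ‖latticePoint p‖ ≤ R := by
      intro p hp
      by_contra! hlt
      apply hp
      simp only [g]
      rw [tent_eq_zero hlt.le, map_zero, inner_zero_left, zero_smul]
    have hC0 : (0 : ℝ) ≤ C := by positivity
    rw [← finsum_eq_sum_of_support_subset (s := B) fun p => ⟪g p, u i x⟫_ℂ • e (y p),
      ← finsum_eq_sum_of_support_subset (s := B)
        fun p => ⟪g (σ i p), u i x⟫_ℂ • e (y (σ i p))]
    · exact (finsum_comp_equiv (σ i) (f := fun p => ⟪g p, u i x⟫_ℂ • e (y p))).symm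
    · intro p hp
      refine mem_latticeBox_of_norm_le ?_
      have h3 := hg _ hp
      have h4 := norm_sub_norm_le (U i (latticePoint p)) (latticePoint (σ i p))
      rw [norm_sub_rev, (U i).norm_map] at h4
      linarith [hC i p]
    · intro p hp
      exact mem_latticeBox_of_norm_le (by linarith [hg p hp])
  have h3 : ∀ p, ‖⟪g p, x⟫_ℂ - ⟪g (σ i p), u i x⟫_ℂ‖ ≤ 2 * R * C * ‖x‖ := by
    intro p
    rw [← (u i).inner_map_map, ← inner_sub_left]
    refine (norm_inner_le_norm _ _).trans ?_
    rw [(u i).norm_map]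
    gcongr
    have h4 : u i (g p) = β.symm (tent R (U i (latticePoint p))) := by
      rw [← map_tent]
      simp [U, uR, g]
      rfl
    rw [h4, ← map_sub, β.symm.norm_map, norm_sub_rev]
    refine (norm_tent_sub_tent_le hR _ _).trans ?_
    gcongr
    exact hC i p
  have h5 : ‖(permUnitary e (θ i) : H →L[ℂ] H) (T x) - T (u i x)‖ ≤ c * (ε * ‖x‖) := by
    rw [h1, h2, ← Finset.sum_sub_distrib]
    simp only [← sub_smul]
    rw [← sq_le_sq₀ (norm_nonneg _) (by positivity)]
    have hinj : Set.InjOn (fun p => y (σ i p)) B := fun p hp q hq h =>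
      (σ i).injective (hyσ i ⟨p, hp, rfl⟩ ⟨q, hq, rfl⟩ h)
    rw [norm_sum_smul_basis_sq e (y := fun p => y (σ i p)) hinj]
    calc ∑ p ∈ B, ‖⟪g p, x⟫_ℂ - ⟪g (σ i p), u i x⟫_ℂ‖ ^ 2
        ≤ ∑ _p ∈ B, (2 * R * C * ‖x‖) ^ 2 :=
          Finset.sum_le_sum fun p _ => pow_le_pow_left₀ (norm_nonneg _) (h3 p) 2
      _ = (B.card * (2 * R * C) ^ 2) * ‖x‖ ^ 2 := by
          rw [Finset.sum_const, nsmul_eq_mul]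
          ring
      _ ≤ (ε ^ 2 * (Q * 2 / d)) * ‖x‖ ^ 2 := by gcongr
      _ = (c * (ε * ‖x‖)) ^ 2 := by rw [mul_pow, hc2]; ring
  rw [map_smul, ← smul_sub, norm_smul, norm_inv, Complex.norm_real, Real.norm_eq_abs,
    abs_of_pos hc0, inv_mul_le_iff₀ hc0]
  exact h5

end Intertwiner

/-! ### The permutation representation attains the universal norm -/

section Norm

open MatrixFinite GroupAlg Filter Topology

variable {H : Type*} [NormedAddCommGroup H] [InnerProductSpace ℂ H] [CompleteSpace H] {n : ℕ}

/-- Approximate intertwining of the generators passes to group elements. -/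
theorem tendsto_intertwine {F : Type*} [NormedAddCommGroup F] [InnerProductSpace ℂ F]
    [CompleteSpace F] (ρ : FreeGroup (Fin n) →* unitary (F →L[ℂ] F))
    (τ : FreeGroup (Fin n) →* unitary (H →L[ℂ] H)) (V : ℕ → F →ₗᵢ[ℂ] H)
    (hV : ∀ i x, Tendsto (fun k => (τ (FreeGroup.of i) : H →L[ℂ] H) (V k x) -
      V k ((ρ (FreeGroup.of i) : F →L[ℂ] F) x)) atTop (𝓝 0))
    (g : FreeGroup (Fin n)) (x : F) :
    Tendsto (fun k => (τ g : H →L[ℂ] H) (V k x) - V k ((ρ g : F →L[ℂ] F) x)) atTop (𝓝 0) := by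
  induction g using FreeGroup.induction_on generalizing x with
  | C1 => simp
  | of i => exact hV i x
  | inv_of i _ =>
    rw [tendsto_zero_iff_norm_tendsto_zero]
    refine (tendsto_zero_iff_norm_tendsto_zero.1
      (hV i ((ρ (FreeGroup.of i)⁻¹ : F →L[ℂ] F) x))).congr fun k => ?_
    rw [map_inv, map_inv, unitary_apply_inv_apply,
      ← unitary_norm_apply (τ (FreeGroup.of i)) (((τ (FreeGroup.of i))⁻¹ : unitary _).1 _ - _),
      map_sub, unitary_apply_inv_apply, norm_sub_rev]
  | mul g h hg hh =>
    have h1 : Tendsto (fun k => (τ g : H →L[ℂ] H)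
        ((τ h : H →L[ℂ] H) (V k x) - V k ((ρ h : F →L[ℂ] F) x))) atTop (𝓝 0) := by
      have := ((τ g : H →L[ℂ] H).continuous.tendsto 0).comp (hh x)
      rwa [map_zero] at this
    have h2 := h1.add (hg ((ρ h : F →L[ℂ] F) x))
    rw [add_zero] at h2
    refine h2.congr fun k => ?_
    rw [map_mul, map_mul, Submonoid.coe_mul, Submonoid.coe_mul, mul_apply_eq_comp,
      mul_apply_eq_comp, map_sub]
    abel

theorem tendsto_intertwine_integrated {F : Type*} [NormedAddCommGroup F]
    [InnerProductSpace ℂ F] [CompleteSpace F]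
    (ρ : FreeGroup (Fin n) →* unitary (F →L[ℂ] F))
    (τ : FreeGroup (Fin n) →* unitary (H →L[ℂ] H)) (V : ℕ → F →ₗᵢ[ℂ] H)
    (hV : ∀ i x, Tendsto (fun k => (τ (FreeGroup.of i) : H →L[ℂ] H) (V k x) -
      V k ((ρ (FreeGroup.of i) : F →L[ℂ] F) x)) atTop (𝓝 0))
    (a : GroupAlg (FreeGroup (Fin n))) (x : F) :
    Tendsto (fun k => integrated τ a (V k x) - V k (integrated ρ a x)) atTop (𝓝 0) := by
  induction a using GroupAlg.induction with
  | h0 => simp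
  | hadd a b ha hb =>
    have h := ha.add hb
    rw [add_zero] at h
    refine h.congr fun k => ?_
    rw [map_add, map_add, add_apply, add_apply, map_add]
    abel
  | hs g c =>
    have h := (tendsto_intertwine ρ τ V hV g x).const_smul c
    rw [smul_zero] at h
    refine h.congr fun k => ?_
    rw [integrated_single, integrated_single, smul_apply, smul_apply, map_smul, smul_sub]

/-- The permutation representation of a universal tuple weakly contains every finite-dimensional
representation. -/
theorem norm_integrated_apply_le_permRep (e : HilbertBasis ℕ ℂ H) {θ : Fin n → Equiv.Perm ℕ}
    (hθ : IsUniversalTuple θ) {F : Type*} [NormedAddCommGroup F] [InnerProductSpace ℂ F]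
    [FiniteDimensional ℂ F] [CompleteSpace F] (ρ : FreeGroup (Fin n) →* unitary (F →L[ℂ] F))
    (a : GroupAlg (FreeGroup (Fin n))) (x : F) :
    ‖integrated ρ a x‖ ≤ ‖integrated (permRep e θ) a‖ * ‖x‖ := by
  rcases subsingleton_or_nontrivial F with hF | hF
  · rw [Subsingleton.elim (integrated ρ a x) 0, norm_zero]
    positivity
  choose V hV using fun k : ℕ => exists_approx_intertwiner e hθ
    (fun i => Unitary.linearIsometryEquiv (ρ (FreeGroup.of i))) (ε := 1 / ((k : ℝ) + 1))
    (by positivity)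
  have hlim := tendsto_intertwine_integrated ρ (permRep e θ) V (fun i z => by
    refine squeeze_zero_norm (fun k => ?_)
      (by simpa only [zero_mul] using tendsto_one_div_add_atTop_nhds_zero_nat.mul_const ‖z‖)
    have := hV k i z
    rw [permRep, MonoidHom.comp_apply, FreeGroup.lift_apply_of]
    exact this) a x
  have hlim' := hlim.norm.add_const (‖integrated (permRep e θ) a‖ * ‖x‖)
  rw [norm_zero, zero_add] at hlim'
  refine ge_of_tendsto' hlim' fun k => ?_
  calc ‖integrated ρ a x‖ = ‖V k (integrated ρ a x)‖ := ((V k).norm_map _).symm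
    _ ≤ ‖integrated (permRep e θ) a (V k x) - V k (integrated ρ a x)‖ +
        ‖integrated (permRep e θ) a (V k x)‖ := by
      rw [norm_sub_rev]
      exact norm_le_norm_sub_add _ _
    _ ≤ _ := by
      gcongr
      refine (ContinuousLinearMap.le_opNorm _ _).trans ?_
      rw [(V k).norm_map]

theorem norm_integrated_le_permRep (e : HilbertBasis ℕ ℂ H) {θ : Fin n → Equiv.Perm ℕ}
    (hθ : IsUniversalTuple θ) {K : Type*} [NormedAddCommGroup K] [InnerProductSpace ℂ K]
    [CompleteSpace K] (π : FreeGroup (Fin n) →* unitary (K →L[ℂ] K))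
    (a : GroupAlg (FreeGroup (Fin n))) :
    ‖integrated π a‖ ≤ ‖integrated (permRep e θ) a‖ := by
  refine ContinuousLinearMap.opNorm_le_bound _ (norm_nonneg _) fun x => ?_
  obtain ⟨F, hF, hFρ⟩ := exists_finiteDimensional_integrated_apply_eq π a x
  obtain ⟨ρ, hρ⟩ := exists_isCompatible π F
  obtain ⟨hx, h⟩ := hFρ F le_rfl ρ hρ
  rw [← h]
  exact norm_integrated_apply_le_permRep e hθ ρ a ⟨x, hx⟩

/-- The universal norm dominates representations on Hilbert spaces of any universe that are
isometric to a space of the right one. -/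
theorem norm_integrated_le_of_equiv.{v, w} {G : Type v} [Group G] {K : Type w} [NormedAddCommGroup K]
    [InnerProductSpace ℂ K] [CompleteSpace K] {L : Type v} [NormedAddCommGroup L]
    [InnerProductSpace ℂ L] [CompleteSpace L] (T : K ≃ₗᵢ[ℂ] L)
    (π : G →* unitary (K →L[ℂ] K)) (a : GroupAlg G) : ‖integrated π a‖ ≤ univNorm a := by
  let ρ : G →* unitary (L →L[ℂ] L) :=
    { toFun := fun g => ⟨T.conjStarAlgEquiv (π g), Unitary.map_mem _ (π g).2⟩
      map_one' := Subtype.ext (by simp)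
      map_mul' := fun g h => Subtype.ext (by simp) }
  have h : integrated ρ a = T.conjStarAlgEquiv (integrated π a) := by
    induction a using GroupAlg.induction with
    | h0 => simp
    | hadd a b ha hb => rw [map_add, map_add, map_add, ha, hb]
    | hs g c =>
      rw [integrated_single, integrated_single, map_smul]
      rfl
  refine le_trans (le_of_eq ?_) (norm_integrated_le ρ a)
  rw [h]
  exact (StarAlgEquiv.isometry T.conjStarAlgEquiv).norm_map_of_map_zero (map_zero _) _ |>.symm

theorem norm_integrated_permRep (e : HilbertBasis ℕ ℂ H) {θ : Fin n → Equiv.Perm ℕ}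
    (hθ : IsUniversalTuple θ) (a : GroupAlg (FreeGroup (Fin n))) :
    ‖integrated (permRep e θ) a‖ = univNorm a :=
  le_antisymm (norm_integrated_le_of_equiv e.repr (permRep e θ) a)
    (univNorm_le fun _ _ _ _ π => norm_integrated_le_permRep e hθ π a)

end Norm

/-! ### The embedding of the full group C⋆-algebra -/

namespace FullGroupCStar

open GroupAlg

variable {G : Type*} [Group G] {K : Type*} [NormedAddCommGroup K] [InnerProductSpace ℂ K]
  [CompleteSpace K]

/-- A unitary representation that attains the universal norm extends to an isometric unital
`*`-homomorphism on the full group C⋆-algebra. -/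
theorem exists_isometric_extension (π : G →* unitary (K →L[ℂ] K))
    (hπ : ∀ a, ‖integrated π a‖ = univNorm a) :
    ∃ Φ : FullGroupCStar G →⋆ₐ[ℂ] (K →L[ℂ] K),
      (∀ a, Φ (of a) = integrated π a) ∧ Isometry Φ := by
  have hiso : Isometry (integrated π) := AddMonoidHomClass.isometry_of_norm _ hπ
  let Φ : FullGroupCStar G → (K →L[ℂ] K) := UniformSpace.Completion.extension (integrated π)
  have hof : ∀ a, Φ (of a) = integrated π a := fun a =>
    UniformSpace.Completion.extension_coe hiso.uniformContinuous a
  have hΦ : Isometry Φ := hiso.completion_extension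
  have hc := hΦ.continuous
  have hone : Φ 1 = 1 := (hof 1).trans (map_one _)
  have hadd : ∀ x y, Φ (x + y) = Φ x + Φ y := fun x y => by
    refine denseRange_of.induction_on₂ (p := fun x y => Φ (x + y) = Φ x + Φ y)
      (isClosed_eq (by fun_prop) (by fun_prop)) (fun a b => ?_) x y
    rw [← of_add, hof, hof, hof, map_add]
  have hmul : ∀ x y, Φ (x * y) = Φ x * Φ y := fun x y => by
    refine denseRange_of.induction_on₂ (p := fun x y => Φ (x * y) = Φ x * Φ y)
      (isClosed_eq (by fun_prop) (by fun_prop)) (fun a b => ?_) x y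
    rw [← of_mul, hof, hof, hof, map_mul]
  have hsmul : ∀ (r : ℂ) x, Φ (r • x) = r • Φ x := fun r x => by
    -- the scalar action is by definition that of the completion
    have hr : Continuous fun y : FullGroupCStar G => r • y :=
      continuous_const_smul (T := UniformSpace.Completion (GroupAlg G)) r
    refine denseRange_of.induction_on x (isClosed_eq (hc.comp hr) (hc.const_smul r)) fun a => ?_
    rw [← of_smul, hof, hof, map_smul]
  have hstar : ∀ x, Φ (star x) = star (Φ x) := fun x => by
    refine denseRange_of.induction_on x
      (isClosed_eq (hc.comp continuous_star') hc.star) fun a => ?_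
    rw [← of_star, hof, hof, integrated_star]
  let Φ' : FullGroupCStar G →ₐ[ℂ] (K →L[ℂ] K) :=
    AlgHom.ofLinearMap { toFun := Φ, map_add' := hadd, map_smul' := hsmul } hone hmul
  exact ⟨{ Φ' with map_star' := hstar }, hof, hΦ⟩

end FullGroupCStar

theorem mainTheorem10 {H : Type*} [NormedAddCommGroup H] [InnerProductSpace ℂ H]
    [CompleteSpace H] (e : HilbertBasis ℕ ℂ H) (n : ℕ) :
    ∃ φ : FullGroupCStar (FreeGroup (Fin n)) →⋆ₐ[ℂ] MatrixFinite.Bf e,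
      Function.Injective φ := by
  obtain ⟨θ, hθ⟩ := exists_isUniversalTuple n
  obtain ⟨Φ, hΦof, hΦ⟩ := FullGroupCStar.exists_isometric_extension (MatrixFinite.permRep e θ)
    (norm_integrated_permRep e hθ)
  have hmem : ∀ x, Φ x ∈ MatrixFinite.Bf e := fun x => by
    refine FullGroupCStar.denseRange_of.induction_on (p := fun x => Φ x ∈ MatrixFinite.Bf e) x
      ((MatrixFinite.finiteOps e).isClosed_topologicalClosure.preimage hΦ.continuous) fun a => ?_
    rw [hΦof]
    exact (MatrixFinite.finiteOps e).le_topologicalClosure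
      (MatrixFinite.integrated_permRep_mem_finiteOps e θ a)
  refine ⟨Φ.codRestrict _ hmem, fun x y hxy => hΦ.injective ?_⟩
  exact congrArg Subtype.val hxy
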